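/- A hypergraph is a pair $(V,E)$, where $V$ is a finite set of vertices and $E$ is a multiset of subsets of $V$, called edges, each having at least two elements (repeated edges are allowed and count as different edges). A walk is a sequence $v_0,e_1,v_1,\dots,e_m,v_m$ with $v_i\in V$, $e_i\in E$ and $\{v_{i-1},v_i\}\subseteq e_i$ for all $i$; it is a path if all the $v_i$ are distinct and all the $e_i$ are distinct, and a cycle if $m\ge 2$, all the $e_i$ are distinct, and all the $v_i$ are distinct except that $v_0=v_m$. A hypertree is a hypergraph with no cycles in which any two vertices are joined by a path. For $n\ge 1$ and a finitely supported sequence $\lambda=(\lambda_2,\lambda_3,\dots)$ of nonnegative integers, let $\tau_{n,\lambda}$ be the number of labeled hypertrees with vertex set $[n]=\{1,\dots,n\}$ and with $\lambda_i$ edges of size $i$ for each $i\ge2$, the edges of size $i$ being labeled by $[\lambda_i]$. Define the formal power series $$T(t;u_2,u_3,\dots)=\sum_{n\ge1}\frac{t^n}{n!}\sum_{\lambda}\tau_{n,\lambda}\,\frac{u_2^{\lambda_2}u_3^{\lambda_3}\cdots}{\lambda_2!\,\lambda_3!\cdots},\qquad R=t\,\frac{\partial T}{\partial t}.$$ For each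 $n$ the inner sum is finite. Let $\tilde T(t),\tilde R(t)\in\mathbb{Q}[[t]]$ be obtained from $T$ and $R$ by setting $u_j=1$ for all $j$. Then $\tilde T$ and $\tilde R$ are the exponential generating functions of hypertrees and of rooted hypertrees by number of vertices: for $n\ge 1$ the coefficient of $t^n/n!$ in $\tilde T$ is the number of hypertrees with vertex set $[n]$ (edges unlabeled), the coefficient of $t^n/n!$ in $\tilde R$ is the number of pairs of such a hypertree and a vertex of it, and both constant terms are $0$. Moreover, $$\tilde T=(e^{\tilde R}-1)(1-\tilde R).$$ -/

import Mathlib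

/-- A hypergraph with vertex type `V` whose edges are indexed by a type `E`. Each edge has at least
two vertices; different indices are different edges, even if they have the same vertices. -/
structure IndexedHypergraph (V E : Type) where
  /-- the set of vertices of an edge -/
  verts : E → Finset V
  two_le : ∀ e, 2 ≤ (verts e).card

namespace IndexedHypergraph

/-- `v 0, e 0, v 1, …, e (m - 1), v m` is a walk with `m` edges. -/
def IsWalk {V E : Type} (H : IndexedHypergraph V E) {m : ℕ} (v : Fin (m + 1) → V)
    (e : Fin m → E) : Prop :=
  ∀ i : Fin m, v i.castSucc ∈ H.verts (e i) ∧ v i.succ ∈ H.verts (e i)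

/-- A path is a walk in which all vertices are distinct and all edges are distinct. -/
def IsPath {V E : Type} (H : IndexedHypergraph V E) {m : ℕ} (v : Fin (m + 1) → V)
    (e : Fin m → E) : Prop :=
  H.IsWalk v e ∧ Function.Injective v ∧ Function.Injective e

/-- A cycle is a walk with at least two edges in which all edges are distinct and all vertices are
distinct, except that the first and the last one agree. -/
def IsCycle {V E : Type} (H : IndexedHypergraph V E) {m : ℕ} (v : Fin (m + 1) → V)
    (e : Fin m → E) : Prop :=
  H.IsWalk v e ∧ 2 ≤ m ∧ Function.Injective e ∧
    Function.Injective (fun i : Fin m => v i.castSucc) ∧ v 0 = v (Fin.last m)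

/-- Any two vertices are the ends of a path. -/
def IsConnected {V E : Type} (H : IndexedHypergraph V E) : Prop :=
  ∀ x y : V, ∃ (m : ℕ) (v : Fin (m + 1) → V) (e : Fin m → E),
    H.IsPath v e ∧ v 0 = x ∧ v (Fin.last m) = y

/-- A hypertree is a connected hypergraph with no cycles. -/
def IsHypertree {V E : Type} (H : IndexedHypergraph V E) : Prop :=
  H.IsConnected ∧ ∀ (m : ℕ) (v : Fin (m + 1) → V) (e : Fin m → E), ¬ H.IsCycle v e

/-- A hypertree has no repeated edge. -/
theorem IsHypertree.verts_injective {V E : Type} {H : IndexedHypergraph V E}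
    (h : H.IsHypertree) : Function.Injective H.verts := by
  intro e f hef
  by_contra hne
  obtain ⟨a, ha, b, hb, hab⟩ := Finset.one_lt_card.mp (H.two_le e)
  refine h.2 2 ![a, b, a] ![e, f] ⟨?_, le_rfl, ?_, ?_, rfl⟩
  · intro i
    fin_cases i
    · exact ⟨ha, hb⟩
    · exact ⟨hef ▸ hb, hef ▸ ha⟩
  · intro i j hij
    fin_cases i <;> fin_cases j <;> simp_all
  · intro i j hij
    fin_cases i <;> fin_cases j <;> simp_all

end IndexedHypergraph

/-- A hypergraph with vertex set `V`: a multiset of subsets of `V` with at least two elements. -/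
structure MultiHypergraph (V : Type) where
  /-- the multiset of edges -/
  edges : Multiset (Finset V)
  two_le : ∀ e ∈ edges, 2 ≤ e.card

namespace MultiHypergraph

/-- The same hypergraph, with its edges indexed by the occurrences of sets in the multiset. -/
def toIndexed {V : Type} [DecidableEq V] (H : MultiHypergraph V) :
    IndexedHypergraph V H.edges.ToType where
  verts x := x.1
  two_le x := H.two_le _ (Multiset.coe_mem (x := x))

/-- A hypertree is a connected hypergraph with no cycles. -/
def IsHypertree {V : Type} [DecidableEq V] (H : MultiHypergraph V) : Prop :=
  H.toIndexed.IsHypertree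

end MultiHypergraph

/-- The number of hypertrees with vertex set `[n]` (the edges carry no labels). -/
noncomputable def numHypertrees (n : ℕ) : ℕ :=
  Nat.card {H : MultiHypergraph (Fin n) // H.IsHypertree}

/-- The number of rooted hypertrees with vertex set `[n]`, that is, of pairs of a hypertree with
vertex set `[n]` and one of its vertices. -/
noncomputable def numRootedHypertrees (n : ℕ) : ℕ :=
  Nat.card {p : MultiHypergraph (Fin n) × Fin n // p.1.IsHypertree}

/-- A labeled hypergraph with `l i` edges of size `i` for each `i`: its vertices are labeled by
`[n]` and its edges of size `i` are labeled by `[l i]`. -/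
structure LabeledHypergraph (n : ℕ) (l : ℕ →₀ ℕ) extends
    IndexedHypergraph (Fin n) (Σ i : ℕ, Fin (l i)) where
  card_verts : ∀ e, (verts e).card = e.1

/-- `τ_{n,l}`: the number of labeled hypertrees on `[n]` with `l i` edges of size `i`. -/
noncomputable def numLabeledHypertrees (n : ℕ) (l : ℕ →₀ ℕ) : ℕ :=
  Nat.card {H : LabeledHypergraph n l // H.toIndexedHypergraph.IsHypertree}

/-- `l! = ∏ i, (l i)!` -/
def edgeFactorial (l : ℕ →₀ ℕ) : ℕ := l.prod fun _ k => Nat.factorial k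

/-- For given `n`, only finitely many `l` are possible. -/
theorem finite_numLabeledHypertrees_ne_zero (n : ℕ) :
    {l : ℕ →₀ ℕ | numLabeledHypertrees n l ≠ 0}.Finite := by
  refine (Set.finite_Iic
    (Finsupp.onFinset (Finset.range (n + 1)) (fun i => if i < n + 1 then 2 ^ n else 0)
      (by intro i hi; by_contra h; simp_all))).subset ?_
  intro l hl i
  have hne : Nonempty {H : LabeledHypergraph n l // H.toIndexedHypergraph.IsHypertree} := by
    by_contra h
    rw [not_nonempty_iff] at h
    exact hl Nat.card_of_isEmpty
  obtain ⟨H, hH⟩ := hne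
  have hcard : l i ≤ 2 ^ n := by
    have hinj : Function.Injective (fun k : Fin (l i) => H.verts ⟨i, k⟩) := by
      intro a b hab
      simpa using hH.verts_injective hab
    simpa using Fintype.card_le_of_injective _ hinj
  by_cases hi : i < n + 1
  · simpa only [Finsupp.onFinset_apply, if_pos hi] using hcard
  · have : l i = 0 := by
      by_contra h0
      have h1 := H.card_verts ⟨i, ⟨0, Nat.pos_of_ne_zero h0⟩⟩
      have h2 := Finset.card_le_univ (H.verts ⟨i, ⟨0, Nat.pos_of_ne_zero h0⟩⟩)
      simp only [Fintype.card_fin] at h2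
      simp only at h1
      omega
    simp [this]

/-- `T_n = ∑ l, τ_{n,l} u^l / l!`, a polynomial in the indeterminates `u_i`. (There are no edges
with fewer than two vertices, so `u_0` and `u_1` do not occur in it.) -/
noncomputable def hypertreePoly (n : ℕ) : MvPolynomial ℕ ℚ :=
  ∑ᶠ l : ℕ →₀ ℕ, MvPolynomial.monomial l ((numLabeledHypertrees n l : ℚ) / edgeFactorial l)

theorem coeff_hypertreePoly (n : ℕ) (l : ℕ →₀ ℕ) :
    MvPolynomial.coeff l (hypertreePoly n) =
      (numLabeledHypertrees n l : ℚ) / edgeFactorial l := by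
  classical
  have hs : (Function.support fun l : ℕ →₀ ℕ => MvPolynomial.monomial l
      ((numLabeledHypertrees n l : ℚ) / edgeFactorial l)) ⊆
      ((finite_numLabeledHypertrees_ne_zero n).toFinset : Set (ℕ →₀ ℕ)) := by
    intro k hk
    simp only [Set.Finite.coe_toFinset, Set.mem_ofPred_eq]
    intro h0
    simp [h0] at hk
  rw [hypertreePoly, finsum_eq_sum_of_support_subset _ hs, MvPolynomial.coeff_sum]
  simp only [MvPolynomial.coeff_monomial, Finset.sum_ite_eq', Set.Finite.mem_toFinset,
    Set.mem_ofPred_eq]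
  by_cases h : numLabeledHypertrees n l = 0 <;> simp [h]

/-- `T(t; u_2, u_3, …) = ∑_{n ≥ 1} T_n t^n / n!`, the exponential generating function of
hypertrees, as a power series in `t` over the polynomials in the `u_i`. -/
noncomputable def hypertreeSeries : PowerSeries (MvPolynomial ℕ ℚ) :=
  PowerSeries.mk fun n =>
    if n = 0 then 0 else MvPolynomial.C (1 / (Nat.factorial n : ℚ)) * hypertreePoly n

/-- `R = t ∂T/∂t`, the exponential generating function of rooted hypertrees. -/
noncomputable def rootedHypertreeSeries : PowerSeries (MvPolynomial ℕ ℚ) :=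
  PowerSeries.X * PowerSeries.derivative (MvPolynomial ℕ ℚ) hypertreeSeries

/-- The specialization `u_j = 1` for all `j`. -/
noncomputable def specializeOne (F : PowerSeries (MvPolynomial ℕ ℚ)) : PowerSeries ℚ :=
  PowerSeries.map (MvPolynomial.eval fun _ : ℕ => (1 : ℚ)) F

/-! The identity is an Euler characteristic count. In a connected hypergraph, acyclicity is
equivalent to `∑ (|e| - 1) + 1 = |V|` (`IndexedHypergraph.isHypertree_iff`), so every hypertree on
`n` vertices satisfies `1 = n - ∑ (|e| - 1)`. Summing over hypertrees, `T` becomes the series of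
trees with a marked vertex, minus the series of trees with a marked edge, where an edge of size `d`
has weight `d - 1`.

Marking a vertex gives `R`. Deleting a marked edge of size `d` leaves `d` trees, each rooted at its
vertex on that edge, and conversely `d` rooted trees can be joined along their roots; hence trees
with a marked edge of size `d` have series `R^d / d!` (`card_spanTrees_filter_mem`,
`sum_prod_numRootedHypertrees`, `factorial_mul_coeff_pow`). Therefore `T = R - ∑_{d ≥ 2} (d - 1) R^d
/ d!`, and the right side is `(e^x - 1)(1 - x)` at `x = R` (`coeff_exp_sub_one_mul`).

The counting description of the specialized series holds because the edges of a hypertree are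
distinct sets: a tree with edge profile `l` has exactly `l!` edge labelings (`card_edgeLabeling`),
which cancels the denominator in `T`. -/

/-! ### Trees as connected edge sets with the right vertex count -/

/-- A set `A` of vertices is a union of connected components of the hypergraph with edge set `S`. -/
def EdgeClosed {V : Type} (S : Finset (Finset V)) (A : Finset V) : Prop :=
  ∀ e ∈ S, ∀ x ∈ e, x ∈ A → e ⊆ A

theorem EdgeClosed.sdiff {V : Type} [DecidableEq V] {S : Finset (Finset V)} {U A : Finset V}
    (hU : EdgeClosed S U) (hA : EdgeClosed S A) : EdgeClosed S (U \ A) := by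
  intro e he x hx hxU y hy
  rw [Finset.mem_sdiff] at hxU ⊢
  exact ⟨hU e he x hx hxU.1 hy, fun hyA => hxU.2 (hA e he y hy hyA hx)⟩

/-- If the components of `S` which meet `A` cover `U`, then `|U| ≤ |A| + ∑ (|e| - 1)`. -/
theorem card_le_of_edgeClosed {V : Type} [DecidableEq V] (U : Finset V) (S : Finset (Finset V)) :
    ∀ A : Finset V, (∀ e ∈ S, e ⊆ U) → A ⊆ U →
      (∀ B, A ⊆ B → B ⊆ U → EdgeClosed S B → B = U) →
      U.card ≤ A.card + ∑ e ∈ S, (e.card - 1) := by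
  induction S using Finset.strongInduction with
  | H S ih =>
    intro A hS hAU h
    by_cases hc : EdgeClosed S A
    · rw [h A subset_rfl hAU hc]
      exact Nat.le_add_right _ _
    · simp only [EdgeClosed, not_forall] at hc
      -- The edge `e` meets `A`, so passing to `A ∪ e` adds at most `|e| - 1` vertices; once
      -- absorbed, `e` imposes no further condition and can leave `S`.
      obtain ⟨e, he, x, hx, hxA, -⟩ := hc
      have h1 := ih (S.erase e) (Finset.erase_ssubset he) (A ∪ e)
        (fun f hf => hS f (Finset.mem_of_mem_erase hf)) (Finset.union_subset hAU (hS e he)) ?_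
      · have h2 := Finset.card_union_add_card_inter A e
        have h3 : 0 < (A ∩ e).card := Finset.card_pos.mpr ⟨x, Finset.mem_inter.mpr ⟨hxA, hx⟩⟩
        have h4 := Finset.add_sum_erase S (fun e => e.card - 1) he
        have h5 : 0 < e.card := Finset.card_pos.mpr ⟨x, hx⟩
        omega
      · intro B hAB hBU hB
        refine h B (Finset.union_subset_left hAB) hBU ?_
        intro f hf y hy hyB
        by_cases hfe : f = e
        · exact hfe ▸ Finset.union_subset_right hAB
        · exact hB f (Finset.mem_erase.mpr ⟨hfe, hf⟩) y hy hyB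

/-- The sets in `S` are the edges of a hypertree with vertex set `U`; the absence of cycles is
expressed by the number of vertices. -/
structure IsSpanTree {V : Type} (U : Finset V) (S : Finset (Finset V)) : Prop where
  two_le : ∀ e ∈ S, 2 ≤ e.card
  subset : ∀ e ∈ S, e ⊆ U
  conn : ∀ A ⊆ U, A.Nonempty → EdgeClosed S A → A = U
  count : ∑ e ∈ S, (e.card - 1) + 1 = U.card

/-! ### Absence of cycles versus the vertex count -/

namespace IndexedHypergraph

/-- Two vertices are adjacent if they lie in a common edge whose index is in `F`. -/
def sectionGraph {V E : Type} (H : IndexedHypergraph V E) (F : Finset E) : SimpleGraph V where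
  Adj x y := x ≠ y ∧ ∃ e ∈ F, x ∈ H.verts e ∧ y ∈ H.verts e
  symm := ⟨fun _ _ ⟨h, e, he, hx, hy⟩ => ⟨h.symm, e, he, hy, hx⟩⟩
  loopless := ⟨fun _ h => h.1 rfl⟩

theorem sectionGraph_mono {V E : Type} (H : IndexedHypergraph V E) {F G : Finset E} (h : F ⊆ G) :
    H.sectionGraph F ≤ H.sectionGraph G :=
  fun _ _ ⟨hne, e, he, hxy⟩ => ⟨hne, e, h he, hxy⟩

theorem sectionGraph_reachable_of_mem {V E : Type} (H : IndexedHypergraph V E) {F : Finset E}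
    {e : E} (he : e ∈ F) {x y : V} (hx : x ∈ H.verts e) (hy : y ∈ H.verts e) :
    (H.sectionGraph F).Reachable x y := by
  by_cases h : x = y
  · exact h ▸ SimpleGraph.Reachable.refl x
  · exact SimpleGraph.Adj.reachable ⟨h, e, he, hx, hy⟩

/-- A shortest walk gives a path. -/
theorem exists_isPath_of_reachable {V E : Type} (H : IndexedHypergraph V E) (F : Finset E)
    {x y : V} (h : (H.sectionGraph F).Reachable x y) :
    ∃ (m : ℕ) (v : Fin (m + 1) → V) (e : Fin m → E),
      H.IsPath v e ∧ v 0 = x ∧ v (Fin.last m) = y ∧ ∀ i, e i ∈ F := by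
  obtain ⟨p, hp⟩ := h.exists_walk_length_eq_dist
  have hadj : ∀ i : Fin p.length, ∃ e ∈ F, p.getVert i ∈ H.verts e ∧
      p.getVert (i + 1) ∈ H.verts e := fun i => (p.adj_getVert_succ i.2).2
  choose e heF he1 he2 using hadj
  refine ⟨p.length, fun i => p.getVert i, e, ⟨fun i => ⟨he1 i, he2 i⟩, ?_, ?_⟩, by simp, by simp,
    heF⟩
  · intro i j hij
    exact Fin.ext ((p.isPath_of_length_eq_dist hp).getVert_injOn (Nat.le_of_lt_succ i.2)
      (Nat.le_of_lt_succ j.2) hij)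
  -- If an edge occurred at steps `i < j`, it would contain the vertices at positions `i` and `j +
  -- 1`, and going directly between them would shorten a shortest walk.
  · have key : ∀ i j : Fin p.length, i < j → e i ≠ e j := by
      intro i j hij hee
      have hsh : ∃ q : (H.sectionGraph F).Walk (p.getVert i) (p.getVert (j + 1)), q.length ≤ 1 := by
        by_cases heq : p.getVert i = p.getVert (j + 1)
        · exact ⟨SimpleGraph.Walk.nil.copy rfl heq, by simp⟩
        · have : (H.sectionGraph F).Adj (p.getVert i) (p.getVert (j + 1)) :=
            ⟨heq, e i, heF i, he1 i, hee ▸ he2 j⟩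
          exact ⟨this.toWalk, by simp⟩
      obtain ⟨q, hq⟩ := hsh
      have hd := SimpleGraph.dist_le (((p.take i).append q).append (p.drop (j + 1)))
      have hij' : (i : ℕ) < j := hij
      have := j.2
      simp only [SimpleGraph.Walk.length_append, SimpleGraph.Walk.take_length,
        SimpleGraph.Walk.drop_length] at hd
      omega
    intro i j hij
    rcases lt_trichotomy i j with h | h | h
    · exact absurd hij (key i j h)
    · exact h
    · exact absurd hij.symm (key j i h)

/-- The edge `e₀` closes up a path that runs inside `F`. It differs from the path's edges because
`e₀ ∉ F`, and `x ≠ y` makes the path nontrivial, so the cycle has at least two edges. -/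
theorem exists_isCycle_of_reachable {V E : Type} (H : IndexedHypergraph V E) (F : Finset E)
    {x y : V} (hxy : x ≠ y) (h : (H.sectionGraph F).Reachable x y) {e₀ : E} (he₀ : e₀ ∉ F)
    (hx : x ∈ H.verts e₀) (hy : y ∈ H.verts e₀) :
    ∃ (m : ℕ) (v : Fin (m + 1) → V) (e : Fin m → E), H.IsCycle v e := by
  obtain ⟨m, v, e, ⟨hw, hv, he⟩, h0, hm, hF⟩ := H.exists_isPath_of_reachable F h
  have hmpos : m ≠ 0 := by
    rintro rfl
    exact hxy (h0.symm.trans hm)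
  refine ⟨m + 1, Fin.snoc v x, Fin.snoc e e₀, ?_, by omega, ?_, ?_, ?_⟩
  · intro i
    refine Fin.lastCases ?_ (fun i => ?_) i
    · simp [hm, hx, hy]
    · rw [Fin.succ_castSucc]
      simpa only [Fin.snoc_castSucc] using hw i
  · rw [Fin.snoc_injective_iff]
    refine ⟨he, ?_⟩
    rintro ⟨i, rfl⟩
    exact he₀ (hF i)
  · simpa using hv
  · rw [Fin.snoc_last, ← Fin.castSucc_zero, Fin.snoc_castSucc, h0]

theorem IsConnected.edgeClosed {V E : Type} [Fintype V] [Fintype E] [DecidableEq V]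
    {H : IndexedHypergraph V E} (hH : H.IsConnected) {A : Finset V} (hA : A.Nonempty)
    (hc : EdgeClosed (Finset.univ.image H.verts) A) : A = Finset.univ := by
  obtain ⟨x, hx⟩ := hA
  refine Finset.eq_univ_of_forall fun y => ?_
  obtain ⟨m, v, e, ⟨hw, -, -⟩, h0, hm⟩ := hH x y
  have : ∀ i, v i ∈ A := by
    intro i
    induction i using Fin.induction with
    | zero => exact h0 ▸ hx
    | succ i ih =>
      exact hc _ (Finset.mem_image_of_mem _ (Finset.mem_univ (e i))) _ (hw i).1 ih (hw i).2
  exact hm ▸ this _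

theorem isConnected_of_edgeClosed {V E : Type} [Fintype V] [Fintype E] [DecidableEq V]
    {H : IndexedHypergraph V E} (h : ∀ A : Finset V, A.Nonempty →
      EdgeClosed (Finset.univ.image H.verts) A → A = Finset.univ) : H.IsConnected := by
  classical
  intro x y
  have hA := h (Finset.univ.filter fun z => (H.sectionGraph Finset.univ).Reachable x z)
    ⟨x, by simp⟩ ?_
  · have hy : y ∈ Finset.univ.filter fun z => (H.sectionGraph Finset.univ).Reachable x z :=
      hA.ge (Finset.mem_univ y)
    obtain ⟨m, v, e, hp, h0, hm, -⟩ := H.exists_isPath_of_reachable _ (Finset.mem_filter.mp hy).2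
    exact ⟨m, v, e, hp, h0, hm⟩
  · intro s hs z hz hzA w hw
    obtain ⟨e, -, rfl⟩ := Finset.mem_image.mp hs
    simp only [Finset.mem_filter, Finset.mem_univ, true_and] at hzA ⊢
    exact hzA.trans (H.sectionGraph_reachable_of_mem (Finset.mem_univ e) hz hw)

/-- A connected piece `A` grows edge by edge. An unused edge sharing two vertices with `A` would
close a cycle, so an edge meeting `A` adds exactly `|e| - 1` vertices and the count persists;
connectedness lets the growth continue to all of `V`. The induction variable bounds the number of
unused edges. -/
theorem count_of_acyclic {V E : Type} [Fintype V] [Fintype E] [DecidableEq V] [DecidableEq E]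
    {H : IndexedHypergraph V E} (hH : H.IsHypertree) (k : ℕ) :
    ∀ (F : Finset E) (A : Finset V), A.Nonempty → Fᶜ.card ≤ k →
      (∀ x ∈ A, ∀ y ∈ A, (H.sectionGraph F).Reachable x y) → (∀ e ∈ F, H.verts e ⊆ A) →
      ∑ e ∈ F, ((H.verts e).card - 1) + 1 = A.card →
      ∑ e, ((H.verts e).card - 1) + 1 = Fintype.card V := by
  have hmeet : ∀ (F : Finset E) (A : Finset V), (∀ x ∈ A, ∀ y ∈ A,
      (H.sectionGraph F).Reachable x y) → ∀ e ∉ F, ((H.verts e) ∩ A).card ≤ 1 := by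
    intro F A hr e he
    by_contra hlt
    obtain ⟨x, hx, y, hy, hxy⟩ := Finset.one_lt_card.mp (not_le.mp hlt)
    rw [Finset.mem_inter] at hx hy
    obtain ⟨m, v, f, hc⟩ := H.exists_isCycle_of_reachable F hxy (hr x hx.2 y hy.2) he hx.1 hy.1
    exact hH.2 m v f hc
  induction k with
  | zero =>
    intro F A hA hF hr hsub hcount
    obtain rfl : F = Finset.univ := by simpa using hF
    have : A = Finset.univ := hH.1.edgeClosed hA (by
      intro s hs z hz hzA
      obtain ⟨e, he, rfl⟩ := Finset.mem_image.mp hs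
      exact hsub e he)
    rw [hcount, this, Finset.card_univ]
  | succ k ih =>
    intro F A hA hF hr hsub hcount
    by_cases hc : EdgeClosed (Finset.univ.image H.verts) A
    · have hAu := hH.1.edgeClosed hA hc
      have hFu : F = Finset.univ := by
        refine Finset.eq_univ_of_forall fun e => ?_
        by_contra he
        have h1 := hmeet F A hr e he
        have h2 := H.two_le e
        rw [hAu, Finset.inter_univ] at h1
        omega
      rw [← Finset.card_univ, ← hAu, ← hcount, hFu]
    · simp only [EdgeClosed, not_forall] at hc
      obtain ⟨s, hs, x, hx, hxA, hnot⟩ := hc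
      obtain ⟨e, -, rfl⟩ := Finset.mem_image.mp hs
      have heF : e ∉ F := fun he => hnot (hsub e he)
      have hmono := H.sectionGraph_mono (Finset.subset_insert e F)
      have hto : ∀ y ∈ A ∪ H.verts e, (H.sectionGraph (insert e F)).Reachable x y := by
        intro y hy
        rcases Finset.mem_union.mp hy with hy | hy
        · exact (hr x hxA y hy).mono hmono
        · exact H.sectionGraph_reachable_of_mem (Finset.mem_insert_self e F) hx hy
      refine ih (insert e F) (A ∪ H.verts e) (hA.mono Finset.subset_union_left) ?_ ?_ ?_ ?_
      · have : insert e F ≠ F := fun h => heF (Finset.insert_eq_self.mp h)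
        have h1 := Finset.card_compl_add_card (insert e F)
        have h2 := Finset.card_compl_add_card F
        rw [Finset.card_insert_of_notMem heF] at h1
        omega
      · exact fun y hy z hz => (hto y hy).symm.trans (hto z hz)
      · intro f hf
        rcases Finset.mem_insert.mp hf with rfl | hf
        · exact Finset.subset_union_right
        · exact (hsub f hf).trans Finset.subset_union_left
      · have h1 := hmeet F A hr e heF
        have h2 : 0 < ((H.verts e) ∩ A).card :=
          Finset.card_pos.mpr ⟨x, Finset.mem_inter.mpr ⟨hx, hxA⟩⟩
        have h3 := Finset.card_union_add_card_inter A (H.verts e)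
        have h4 := H.two_le e
        rw [Finset.inter_comm] at h3
        rw [Finset.sum_insert heF]
        omega

/-- The vertices of the edges of a cycle are fewer than in a tree. -/
theorem IsCycle.card_biUnion_le {V E : Type} [DecidableEq V] {H : IndexedHypergraph V E} {m : ℕ}
    {v : Fin (m + 1) → V} {e : Fin m → E} (h : H.IsCycle v e) :
    (Finset.univ.biUnion fun i => H.verts (e i)).card ≤ ∑ i, ((H.verts (e i)).card - 1) := by
  obtain ⟨hw, hm, -, hv, h0⟩ := h
  -- The condition `2 ≤ m` matters at the last step, where the successor is `v 0`.
  have hne : ∀ i : Fin m, v i.castSucc ≠ v i.succ := by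
    intro i hi
    by_cases hl : (i : ℕ) + 1 = m
    · have h1 : i.succ = Fin.last m := Fin.ext hl
      have h2 : (0 : Fin (m + 1)) = (⟨0, by omega⟩ : Fin m).castSucc := rfl
      rw [h1, ← h0, h2] at hi
      have := congrArg Fin.val (hv hi)
      simp only at this
      omega
    · have h1 : i.succ = (⟨i + 1, by omega⟩ : Fin m).castSucc := rfl
      rw [h1] at hi
      have := congrArg Fin.val (hv hi)
      simp only at this
      omega
  have hmem : ∀ j : Fin (m + 1), v j ∈ Finset.univ.image fun i : Fin m => v i.castSucc := by
    intro j
    refine Fin.lastCases ?_ (fun j => ?_) j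
    · rw [← h0]
      exact Finset.mem_image.mpr ⟨⟨0, by omega⟩, Finset.mem_univ _, rfl⟩
    · exact Finset.mem_image_of_mem (fun i : Fin m => v i.castSucc) (Finset.mem_univ j)
  -- The cycle has at most `m` vertices of its own, and each edge adds at most `|e| - 2` others,
  -- since two of its vertices are already on the cycle.
  have hsub : (Finset.univ.biUnion fun i => H.verts (e i)) ⊆
      (Finset.univ.image fun i : Fin m => v i.castSucc) ∪
        Finset.univ.biUnion fun i => H.verts (e i) \ {v i.castSucc, v i.succ} := by
    intro x hx
    obtain ⟨i, -, hx⟩ := Finset.mem_biUnion.mp hx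
    by_cases hxi : x ∈ ({v i.castSucc, v i.succ} : Finset V)
    · refine Finset.mem_union_left _ ?_
      rcases Finset.mem_insert.mp hxi with rfl | hxi
      · exact hmem _
      · exact Finset.mem_singleton.mp hxi ▸ hmem _
    · exact Finset.mem_union_right _ (Finset.mem_biUnion.mpr
        ⟨i, Finset.mem_univ i, Finset.mem_sdiff.mpr ⟨hx, hxi⟩⟩)
  have hcard : ∀ i : Fin m, (H.verts (e i) \ {v i.castSucc, v i.succ}).card =
      (H.verts (e i)).card - 2 := by
    intro i
    rw [Finset.card_sdiff_of_subset, Finset.card_pair (hne i)]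
    intro x hx
    rcases Finset.mem_insert.mp hx with rfl | hx
    · exact (hw i).1
    · exact Finset.mem_singleton.mp hx ▸ (hw i).2
  calc _ ≤ _ := Finset.card_le_card hsub
    _ ≤ _ := Finset.card_union_le _ _
    _ ≤ m + ∑ i, ((H.verts (e i)).card - 2) := by
      refine Nat.add_le_add ((Finset.card_image_le).trans (by simp)) ?_
      exact (Finset.card_biUnion_le).trans (Finset.sum_le_sum fun i _ => (hcard i).le)
    _ = ∑ i : Fin m, (1 + ((H.verts (e i)).card - 2)) := by
      rw [Finset.sum_add_distrib]; simp
    _ = _ := Finset.sum_congr rfl fun i _ => by have := H.two_le (e i); omega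

/-- Forward, the growth argument starts from a single vertex and no edges. Backward, the edges of a
cycle cover at most `∑ (|e| - 1)` vertices, and the remaining edges add at most `|e| - 1` each;
together they fall one short of the prescribed count. -/
theorem isHypertree_iff {V E : Type} [Fintype V] [Nonempty V] [Fintype E] [DecidableEq V]
    (H : IndexedHypergraph V E) :
    H.IsHypertree ↔ Function.Injective H.verts ∧
      IsSpanTree Finset.univ (Finset.univ.image H.verts) := by
  classical
  constructor
  · intro h
    refine ⟨h.verts_injective, ?_, fun e _ => Finset.subset_univ e,
      fun A _ hA hc => h.1.edgeClosed hA hc, ?_⟩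
    · intro s hs
      obtain ⟨e, -, rfl⟩ := Finset.mem_image.mp hs
      exact H.two_le e
    · rw [Finset.sum_image fun _ _ _ _ h' => h.verts_injective h', Finset.card_univ]
      obtain ⟨x⟩ := ‹Nonempty V›
      exact count_of_acyclic h _ ∅ {x} ⟨x, by simp⟩ le_rfl (by simp) (by simp) (by simp)
  · rintro ⟨hinj, hT⟩
    refine ⟨isConnected_of_edgeClosed fun A hA hc => hT.conn A (Finset.subset_univ A) hA hc, ?_⟩
    intro m v e hcyc
    have hA := hcyc.card_biUnion_le
    set A := Finset.univ.biUnion fun i => H.verts (e i) with hAdef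
    set S := Finset.univ.image H.verts with hSdef
    set C := Finset.univ.image fun i => H.verts (e i) with hCdef
    have hCS : C ⊆ S := by
      intro s hs
      obtain ⟨i, -, rfl⟩ := Finset.mem_image.mp hs
      exact Finset.mem_image_of_mem _ (Finset.mem_univ _)
    have hCsum : ∑ s ∈ C, (s.card - 1) = ∑ i, ((H.verts (e i)).card - 1) :=
      Finset.sum_image fun i _ j _ hij => hcyc.2.2.1 (hinj hij)
    have hAne : A.Nonempty :=
      ⟨_, Finset.mem_biUnion.mpr ⟨⟨0, by have := hcyc.2.1; omega⟩, Finset.mem_univ _,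
        (hcyc.1 _).1⟩⟩
    have hg := card_le_of_edgeClosed Finset.univ (S \ C) A (fun s _ => Finset.subset_univ s)
      (Finset.subset_univ A) (by
        intro B hAB _ hB
        refine hT.conn B (Finset.subset_univ B) (hAne.mono hAB) ?_
        intro s hs x hx hxB
        by_cases hsC : s ∈ C
        · obtain ⟨i, -, rfl⟩ := Finset.mem_image.mp hsC
          exact (Finset.subset_biUnion_of_mem (fun i => H.verts (e i)) (Finset.mem_univ i)).trans hAB
        · exact hB s (Finset.mem_sdiff.mpr ⟨hs, hsC⟩) x hx hxB)
    have h1 := Finset.sum_sdiff (f := fun s : Finset V => s.card - 1) hCS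
    have h2 := hT.count
    omega

end IndexedHypergraph

/-! ### Unlabeled and rooted hypertrees as edge sets -/

open Classical in
/-- The hypertrees with vertex set `U`. -/
noncomputable def spanTrees {V : Type} [Fintype V] (U : Finset V) : Finset (Finset (Finset V)) :=
  Finset.univ.filter (IsSpanTree U)

theorem mem_spanTrees {V : Type} [Fintype V] {U : Finset V} {S : Finset (Finset V)} :
    S ∈ spanTrees U ↔ IsSpanTree U S := by
  simp [spanTrees]

theorem MultiHypergraph.isHypertree_iff {V : Type} [Fintype V] [Nonempty V] [DecidableEq V]
    (H : MultiHypergraph V) :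
    H.IsHypertree ↔ H.edges.Nodup ∧ IsSpanTree Finset.univ H.edges.toFinset := by
  have him : Finset.univ.image H.toIndexed.verts = H.edges.toFinset := by
    ext s
    rw [Finset.mem_image, Multiset.mem_toFinset]
    constructor
    · rintro ⟨x, -, rfl⟩
      exact Multiset.coe_mem
    · intro hs
      exact ⟨⟨s, ⟨0, Multiset.count_pos.mpr hs⟩⟩, Finset.mem_univ _, rfl⟩
  have hinj : Function.Injective H.toIndexed.verts ↔ H.edges.Nodup := by
    rw [Multiset.nodup_iff_count_le_one]
    constructor
    · intro h s
      by_contra hlt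
      have := @h ⟨s, ⟨0, by omega⟩⟩ ⟨s, ⟨1, by omega⟩⟩ rfl
      exact absurd (congrArg (fun x => (x.2 : ℕ)) this) (by simp)
    · rintro h ⟨s, i⟩ ⟨t, j⟩ (rfl : s = t)
      have := h s
      have : i = j := Fin.ext (by omega)
      rw [this]
  rw [MultiHypergraph.IsHypertree, IndexedHypergraph.isHypertree_iff, him, hinj]

theorem numHypertrees_eq_card_spanTrees {n : ℕ} (hn : n ≠ 0) :
    numHypertrees n = (spanTrees (Finset.univ : Finset (Fin n))).card := by
  have : NeZero n := ⟨hn⟩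
  rw [numHypertrees, ← Nat.card_eq_finsetCard]
  refine Nat.card_congr <| Equiv.ofBijective (fun H => ⟨H.1.edges.toFinset,
    mem_spanTrees.mpr ((MultiHypergraph.isHypertree_iff H.1).mp H.2).2⟩) ⟨?_, ?_⟩
  · rintro ⟨⟨E, hE⟩, hH⟩ ⟨⟨E', hE'⟩, hH'⟩ heq
    have h1 := ((MultiHypergraph.isHypertree_iff _).mp hH).1
    have h2 := ((MultiHypergraph.isHypertree_iff _).mp hH').1
    have h3 : E.toFinset = E'.toFinset := congrArg Subtype.val heq
    have h4 := congrArg Finset.val h3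
    rw [Multiset.toFinset_val, Multiset.toFinset_val, h1.dedup, h2.dedup] at h4
    subst h4
    rfl
  · rintro ⟨S, hS⟩
    rw [mem_spanTrees] at hS
    exact ⟨⟨⟨S.val, hS.two_le⟩, (MultiHypergraph.isHypertree_iff _).mpr
      ⟨S.nodup, by simpa using hS⟩⟩, by simp⟩

theorem numRootedHypertrees_eq (n : ℕ) : numRootedHypertrees n = n * numHypertrees n := by
  have e : {p : MultiHypergraph (Fin n) × Fin n // p.1.IsHypertree} ≃
      {H : MultiHypergraph (Fin n) // H.IsHypertree} × Fin n :=
    { toFun := fun p => (⟨p.1.1, p.2⟩, p.1.2)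
      invFun := fun q => ⟨(q.1.1, q.2), q.1.2⟩
      left_inv := fun _ => rfl
      right_inv := fun _ => rfl }
  rw [numRootedHypertrees, Nat.card_congr e, Nat.card_prod, Nat.card_eq_fintype_card (α := Fin n),
    Fintype.card_fin, numHypertrees, mul_comm]

/-! ### Edge labelings and the specialization of the series -/

/-- The numbers of edges of each size. -/
noncomputable def edgeProfile {V : Type} (S : Finset (Finset V)) : ℕ →₀ ℕ :=
  ∑ e ∈ S, Finsupp.single e.card 1

theorem edgeProfile_apply {V : Type} (S : Finset (Finset V)) (i : ℕ) :
    edgeProfile S i = (S.filter fun e => e.card = i).card := by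
  rw [edgeProfile, Finsupp.finsetSum_apply, Finset.card_filter]
  exact Finset.sum_congr rfl fun e _ => by rw [Finsupp.single_apply]

noncomputable instance fintypeEdgeLabels (l : ℕ →₀ ℕ) : Fintype (Σ i : ℕ, Fin (l i)) :=
  haveI : Finite (Σ i : ℕ, Fin (l i)) := by
    refine Finite.of_injective (β := Σ i : l.support, Fin (l i)) (fun x => ⟨⟨x.1, ?_⟩, x.2⟩) ?_
    · rw [Finsupp.mem_support_iff]
      have := x.2.2
      omega
    · rintro ⟨i, x⟩ ⟨j, y⟩ h
      simp only [Sigma.mk.injEq, Subtype.mk.injEq] at h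
      obtain ⟨rfl, h⟩ := h
      rw [eq_of_heq h]
  Fintype.ofFinite _

theorem card_fst_eq (l : ℕ →₀ ℕ) (i : ℕ) :
    Fintype.card {x : Σ i : ℕ, Fin (l i) // x.1 = i} = l i := by
  rw [Fintype.card_congr (Equiv.sigmaSubtype (β := fun i => Fin (l i)) i), Fintype.card_fin]

/-- The labelings by `l` of the edges of `S`. -/
def EdgeLabeling {V : Type} (l : ℕ →₀ ℕ) (S : Finset (Finset V)) : Type :=
  {v : (Σ i : ℕ, Fin (l i)) → Finset V //
    (∀ e, (v e).card = e.1) ∧ Function.Injective v ∧ ∀ s, s ∈ S ↔ ∃ e, v e = s}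

theorem EdgeLabeling.edgeProfile_eq {V : Type} {l : ℕ →₀ ℕ} {S : Finset (Finset V)}
    (v : EdgeLabeling l S) : edgeProfile S = l := by
  ext i
  rw [edgeProfile_apply, ← card_fst_eq l i, ← Finset.card_univ]
  symm
  refine Finset.card_bij (fun x _ => v.1 x.1) ?_ ?_ ?_
  · intro x _
    exact Finset.mem_filter.mpr ⟨(v.2.2.2 _).mpr ⟨_, rfl⟩, (v.2.1 _).trans x.2⟩
  · intro x _ y _ hxy
    exact Subtype.ext (v.2.2.1 hxy)
  · intro s hs
    obtain ⟨hs, hi⟩ := Finset.mem_filter.mp hs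
    obtain ⟨e, rfl⟩ := (v.2.2.2 s).mp hs
    exact ⟨⟨e, (v.2.1 e).symm.trans hi⟩, Finset.mem_univ _, rfl⟩

theorem nonempty_edgeLabeling {V : Type} (S : Finset (Finset V)) :
    Nonempty (EdgeLabeling (edgeProfile S) S) := by
  have e : ∀ i, Fin (edgeProfile S i) ≃ {x // x ∈ S.filter fun e => e.card = i} := fun i =>
    (finCongr (edgeProfile_apply S i)).trans (Finset.equivFin _).symm
  have hm : ∀ i j, (e i j).1 ∈ S ∧ (e i j).1.card = i := fun i j => Finset.mem_filter.mp (e i j).2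
  refine ⟨fun x => (e x.1 x.2).1, fun x => (hm _ _).2, ?_, fun s => ⟨fun hs => ?_, ?_⟩⟩
  · rintro ⟨i, x⟩ ⟨j, y⟩ h
    simp only at h
    obtain rfl : i = j := (hm i x).2.symm.trans ((congrArg Finset.card h).trans (hm j y).2)
    rw [(e i).injective (Subtype.ext h)]
  · exact ⟨⟨s.card, (e s.card).symm ⟨s, Finset.mem_filter.mpr ⟨hs, rfl⟩⟩⟩, by simp⟩
  · rintro ⟨x, rfl⟩
    exact (hm _ _).1

/-- Permutations of the labels that preserve edge size act simply transitively on the labelings.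
They form the stabilizer of `Sigma.fst`, whose order is the product of the factorials of its fiber
sizes. -/
theorem card_edgeLabeling {V : Type} (l : ℕ →₀ ℕ) (S : Finset (Finset V)) :
    Nat.card (EdgeLabeling l S) = if edgeProfile S = l then edgeFactorial l else 0 := by
  classical
  split_ifs with h
  · subst h
    set l := edgeProfile S
    obtain ⟨v₀⟩ := nonempty_edgeLabeling S
    have hcomp : ∀ g : {g : Equiv.Perm (Σ i : ℕ, Fin (l i)) // Sigma.fst ∘ g = Sigma.fst}, ∀ x,
        (g.1 x).1 = x.1 := fun g x => congrFun g.2 x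
    have e : {g : Equiv.Perm (Σ i : ℕ, Fin (l i)) // Sigma.fst ∘ g = Sigma.fst} ≃
        EdgeLabeling l S := by
      refine Equiv.ofBijective (fun g => ⟨v₀.1 ∘ g.1, fun x => ?_, ?_, fun s => ?_⟩) ⟨?_, ?_⟩
      · exact (v₀.2.1 _).trans (hcomp g x)
      · exact v₀.2.2.1.comp g.1.injective
      · rw [v₀.2.2.2 s]
        exact g.1.surjective.exists
      · intro g g' hgg
        refine Subtype.ext (Equiv.ext fun x => v₀.2.2.1 ?_)
        exact congrFun (congrArg Subtype.val hgg) x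
      · intro v
        have hex : ∀ x, ∃ y, v₀.1 y = v.1 x := fun x =>
          (v₀.2.2.2 _).mp ((v.2.2.2 _).mpr ⟨x, rfl⟩)
        choose g hg using hex
        have hginj : Function.Injective g := fun x y hxy =>
          v.2.2.1 ((hg x).symm.trans ((congrArg v₀.1 hxy).trans (hg y)))
        refine ⟨⟨Equiv.ofBijective g (Finite.injective_iff_bijective.mp hginj), ?_⟩, ?_⟩
        · funext x
          exact (v₀.2.1 (g x)).symm.trans ((congrArg Finset.card (hg x)).trans (v.2.1 x))
        · exact Subtype.ext (funext hg)
    rw [← Nat.card_congr e, Nat.card_eq_fintype_card, DomMulAct.stabilizer_card', edgeFactorial,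
      Finsupp.prod]
    refine Finset.prod_congr ?_ fun i _ => by rw [card_fst_eq]
    ext i
    rw [Finset.mem_image, Finsupp.mem_support_iff]
    constructor
    · rintro ⟨x, -, rfl⟩
      have := x.2.2
      omega
    · intro hi
      exact ⟨⟨i, ⟨0, Nat.pos_of_ne_zero hi⟩⟩, Finset.mem_univ _, rfl⟩
  · have : IsEmpty (EdgeLabeling l S) := ⟨fun v => h v.edgeProfile_eq⟩
    exact Nat.card_of_isEmpty

/-- A labeled hypertree amounts to its set of edges together with a labeling of that set;
injectivity of the edge map ensures that nothing is lost. -/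
theorem numLabeledHypertrees_eq {n : ℕ} (hn : n ≠ 0) (l : ℕ →₀ ℕ) :
    numLabeledHypertrees n l =
      edgeFactorial l *
        ((spanTrees (Finset.univ : Finset (Fin n))).filter fun S => edgeProfile S = l).card := by
  classical
  have : NeZero n := ⟨hn⟩
  have hS : ∀ v : (Σ i : ℕ, Fin (l i)) → Finset (Fin n), ∀ S : Finset (Finset (Fin n)),
      (∀ s, s ∈ S ↔ ∃ e, v e = s) → Finset.univ.image v = S := by
    intro v S h
    ext s
    simp [h s]
  have e : (Σ S : {S // S ∈ spanTrees (Finset.univ : Finset (Fin n))}, EdgeLabeling l S.1) ≃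
      {H : LabeledHypergraph n l // H.toIndexedHypergraph.IsHypertree} := by
    refine Equiv.ofBijective (fun p => ⟨⟨⟨p.2.1, fun e => ?_⟩, p.2.2.1⟩, ?_⟩) ⟨?_, ?_⟩
    · exact (mem_spanTrees.mp p.1.2).two_le _ ((p.2.2.2.2 _).mpr ⟨e, rfl⟩)
    · rw [IndexedHypergraph.isHypertree_iff]
      refine ⟨p.2.2.2.1, ?_⟩
      rw [hS _ _ p.2.2.2.2]
      exact mem_spanTrees.mp p.1.2
    · rintro ⟨⟨S, hT⟩, ⟨v, hv⟩⟩ ⟨⟨S', hT'⟩, ⟨v', hv'⟩⟩ h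
      simp only [Subtype.mk.injEq, LabeledHypergraph.mk.injEq, IndexedHypergraph.mk.injEq] at h
      subst h
      obtain rfl : S = S' := (hS _ _ hv.2.2).symm.trans (hS _ _ hv'.2.2)
      rfl
    · rintro ⟨H, hH⟩
      have h := (IndexedHypergraph.isHypertree_iff _).mp hH
      exact ⟨⟨⟨_, mem_spanTrees.mpr h.2⟩, ⟨H.verts, H.card_verts, h.1, by simp⟩⟩, rfl⟩
  have hfin : ∀ S : {S // S ∈ spanTrees (Finset.univ : Finset (Fin n))},
      Finite (EdgeLabeling l S.1) := fun S => Subtype.finite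
  rw [numLabeledHypertrees, ← Nat.card_congr e, Nat.card_sigma]
  simp_rw [card_edgeLabeling]
  rw [Finset.sum_coe_sort (spanTrees (Finset.univ : Finset (Fin n)))
    (fun S => if edgeProfile S = l then edgeFactorial l else 0), ← Finset.sum_filter,
    Finset.sum_const, smul_eq_mul, mul_comm]

theorem edgeFactorial_ne_zero (l : ℕ →₀ ℕ) : edgeFactorial l ≠ 0 :=
  Finset.prod_ne_zero_iff.mpr fun _ _ => Nat.factorial_ne_zero _

theorem hypertreePoly_eq {n : ℕ} (hn : n ≠ 0) :
    hypertreePoly n = ∑ S ∈ spanTrees (Finset.univ : Finset (Fin n)),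
      MvPolynomial.monomial (edgeProfile S) 1 := by
  classical
  ext l
  have : (edgeFactorial l : ℚ) ≠ 0 := Nat.cast_ne_zero.mpr (edgeFactorial_ne_zero l)
  rw [coeff_hypertreePoly, numLabeledHypertrees_eq hn, MvPolynomial.coeff_sum]
  simp only [MvPolynomial.coeff_monomial, Finset.sum_boole, Nat.cast_mul]
  field_simp

theorem specializeOne_hypertreeSeries :
    specializeOne hypertreeSeries = PowerSeries.mk fun n : ℕ =>
      if n = 0 then 0 else (numHypertrees n : ℚ) / (Nat.factorial n : ℚ) := by
  ext n
  rw [specializeOne, PowerSeries.coeff_map, hypertreeSeries, PowerSeries.coeff_mk,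
    PowerSeries.coeff_mk]
  split_ifs with hn
  · exact map_zero _
  · rw [hypertreePoly_eq hn, numHypertrees_eq_card_spanTrees hn]
    simp [MvPolynomial.eval_monomial, Finsupp.prod, div_eq_inv_mul]

theorem specializeOne_rootedHypertreeSeries :
    specializeOne rootedHypertreeSeries = PowerSeries.mk fun n : ℕ =>
      (numRootedHypertrees n : ℚ) / (Nat.factorial n : ℚ) := by
  have h : specializeOne rootedHypertreeSeries =
      PowerSeries.X * PowerSeries.derivative ℚ (specializeOne hypertreeSeries) := by
    rw [rootedHypertreeSeries, specializeOne, map_mul, PowerSeries.map_X]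
    congr 1
    ext n
    simp [specializeOne, PowerSeries.coeff_derivative]
  rw [h, specializeOne_hypertreeSeries]
  ext n
  cases n with
  | zero => simp [numRootedHypertrees_eq]
  | succ n =>
    rw [PowerSeries.coeff_succ_X_mul, PowerSeries.coeff_derivative, PowerSeries.coeff_mk,
      PowerSeries.coeff_mk, numRootedHypertrees_eq, if_neg n.succ_ne_zero]
    push_cast
    ring

/-! ### Splitting a tree at an edge -/

/-- The fiber of `f` over `i`. -/
def fiberFinset {V ι : Type} [Fintype V] [DecidableEq ι] (f : V → ι) (i : ι) : Finset V :=
  Finset.univ.filter fun x => f x = i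

theorem mem_fiberFinset {V ι : Type} [Fintype V] [DecidableEq ι] {f : V → ι} {i : ι} {x : V} :
    x ∈ fiberFinset f i ↔ f x = i := by
  simp [fiberFinset]

theorem sum_card_fiberFinset {V ι : Type} [Fintype V] [Fintype ι] [DecidableEq ι] (f : V → ι) :
    ∑ i, (fiberFinset f i).card = Fintype.card V :=
  (Finset.card_eq_sum_card_fiberwise fun x _ => Finset.mem_univ (f x)).symm

open Classical in
/-- The connected component of `x`. -/
noncomputable def edgeComponent {V : Type} [Fintype V] (S : Finset (Finset V)) (x : V) :
    Finset V :=
  Finset.univ.filter fun y => ∀ A, EdgeClosed S A → x ∈ A → y ∈ A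

theorem mem_edgeComponent {V : Type} [Fintype V] {S : Finset (Finset V)} {x y : V} :
    y ∈ edgeComponent S x ↔ ∀ A, EdgeClosed S A → x ∈ A → y ∈ A := by
  simp [edgeComponent]

theorem self_mem_edgeComponent {V : Type} [Fintype V] (S : Finset (Finset V)) (x : V) :
    x ∈ edgeComponent S x :=
  mem_edgeComponent.mpr fun _ _ h => h

theorem edgeClosed_edgeComponent {V : Type} [Fintype V] (S : Finset (Finset V)) (x : V) :
    EdgeClosed S (edgeComponent S x) := fun e he _ hy hyC _ hz =>
  mem_edgeComponent.mpr fun A hA hx => hA e he _ hy (mem_edgeComponent.mp hyC A hA hx) hz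

theorem EdgeClosed.edgeComponent_subset {V : Type} [Fintype V] {S : Finset (Finset V)} {A : Finset V}
    (hA : EdgeClosed S A) {x : V} (hx : x ∈ A) : edgeComponent S x ⊆ A :=
  fun _ hy => mem_edgeComponent.mp hy A hA hx

section Glue

variable {V ι : Type} [Fintype V] [DecidableEq V] [Fintype ι] [DecidableEq ι]

/-- Join trees on the fibers of `f` by an edge with one vertex in each fiber. -/
def glueTrees (a : ι ↪ V) (T : ι → Finset (Finset V)) : Finset (Finset V) :=
  insert (Finset.univ.map a) (Finset.univ.biUnion T)

variable {a : ι ↪ V} {f : V → ι} {T : ι → Finset (Finset V)}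

theorem map_notMem_biUnion (hk : 2 ≤ Fintype.card ι) (hf : ∀ i, f (a i) = i)
    (hT : ∀ i, IsSpanTree (fiberFinset f i) (T i)) :
    Finset.univ.map a ∉ Finset.univ.biUnion T := by
  intro h
  obtain ⟨i, -, hi⟩ := Finset.mem_biUnion.mp h
  obtain ⟨j, hj⟩ := Fintype.exists_ne_of_one_lt_card hk i
  have := mem_fiberFinset.mp ((hT i).subset _ hi (Finset.mem_map_of_mem a (Finset.mem_univ j)))
  exact hj ((hf j).symm.trans this)

theorem mem_biUnion_iff_of_subset_fiber (hT : ∀ i, IsSpanTree (fiberFinset f i) (T i)) (i : ι)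
    (s : Finset V) : s ∈ T i ↔ s ∈ Finset.univ.biUnion T ∧ s ⊆ fiberFinset f i := by
  refine ⟨fun h => ⟨Finset.mem_biUnion.mpr ⟨i, Finset.mem_univ i, h⟩, (hT i).subset s h⟩, ?_⟩
  rintro ⟨h, hs⟩
  obtain ⟨j, -, hj⟩ := Finset.mem_biUnion.mp h
  obtain ⟨x, hx⟩ := Finset.card_pos.mp (lt_of_lt_of_le two_pos ((hT j).two_le s hj))
  obtain rfl : f x = i := mem_fiberFinset.mp (hs hx)
  obtain rfl : f x = j := mem_fiberFinset.mp ((hT j).subset s hj hx)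
  exact hj

theorem sum_biUnion_trees (hT : ∀ i, IsSpanTree (fiberFinset f i) (T i)) :
    ∑ e ∈ Finset.univ.biUnion T, (e.card - 1) = ∑ i, ∑ e ∈ T i, (e.card - 1) := by
  refine Finset.sum_biUnion fun i _ j _ hij => Finset.disjoint_left.mpr fun s hi hj => hij ?_
  obtain ⟨x, hx⟩ := Finset.card_pos.mp (lt_of_lt_of_le two_pos ((hT j).two_le s hj))
  exact (mem_fiberFinset.mp ((hT i).subset s hi hx)).symm.trans
    (mem_fiberFinset.mp ((hT j).subset s hj hx))

theorem isSpanTree_glueTrees (hk : 2 ≤ Fintype.card ι) (hf : ∀ i, f (a i) = i)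
    (hT : ∀ i, IsSpanTree (fiberFinset f i) (T i)) :
    IsSpanTree Finset.univ (glueTrees a T) := by
  refine ⟨?_, fun _ _ => Finset.subset_univ _, ?_, ?_⟩
  · intro e he
    rcases Finset.mem_insert.mp he with rfl | he
    · rwa [Finset.card_map, Finset.card_univ]
    · obtain ⟨i, -, hi⟩ := Finset.mem_biUnion.mp he
      exact (hT i).two_le e hi
  · rintro A - ⟨x, hx⟩ hA
    have hfib : ∀ i, ∀ y ∈ fiberFinset f i, y ∈ A → fiberFinset f i ⊆ A := by
      intro i y hy hyA
      -- A closed set meeting a fiber contains it; the joining edge then spreads this to all fibers.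
      have := (hT i).conn (A ∩ fiberFinset f i) Finset.inter_subset_right
        ⟨y, Finset.mem_inter.mpr ⟨hyA, hy⟩⟩ fun e he z hz hzA =>
          Finset.subset_inter (hA e (Finset.mem_insert_of_mem
            (Finset.mem_biUnion.mpr ⟨i, Finset.mem_univ i, he⟩)) z hz (Finset.mem_inter.mp hzA).1)
            ((hT i).subset e he)
      exact Finset.inter_eq_right.mp this
    have h1 : a (f x) ∈ A := hfib (f x) x (mem_fiberFinset.mpr rfl) hx (mem_fiberFinset.mpr (hf _))
    have h2 := hA _ (Finset.mem_insert_self _ _) _ (Finset.mem_map_of_mem a (Finset.mem_univ _)) h1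
    refine Finset.eq_univ_of_forall fun y => ?_
    exact hfib (f y) (a (f y)) (mem_fiberFinset.mpr (hf _))
      (h2 (Finset.mem_map_of_mem a (Finset.mem_univ _))) (mem_fiberFinset.mpr rfl)
  · rw [glueTrees, Finset.sum_insert (map_notMem_biUnion hk hf hT), sum_biUnion_trees hT,
      Finset.card_map, Finset.card_univ, Finset.card_univ, ← sum_card_fiberFinset f]
    have h : ∑ i, (fiberFinset f i).card = ∑ i, (∑ e ∈ T i, (e.card - 1) + 1) :=
      Finset.sum_congr rfl fun i _ => (hT i).count.symm
    rw [h, Finset.sum_add_distrib, Finset.sum_const, Finset.card_univ, smul_eq_mul, mul_one]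
    omega

theorem glueTrees_injective (hk : 2 ≤ Fintype.card ι) (hf : ∀ i, f (a i) = i)
    (hT : ∀ i, IsSpanTree (fiberFinset f i) (T i)) {g : V → ι} {T' : ι → Finset (Finset V)}
    (hg : ∀ i, g (a i) = i) (hT' : ∀ i, IsSpanTree (fiberFinset g i) (T' i))
    (h : glueTrees a T = glueTrees a T') : f = g ∧ T = T' := by
  have hU : Finset.univ.biUnion T = Finset.univ.biUnion T' := by
    rw [← Finset.erase_insert (map_notMem_biUnion hk hf hT),
      ← Finset.erase_insert (map_notMem_biUnion hk hg hT')]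
    exact congrArg (fun S => Finset.erase S _) h
  -- Each edge of the tree on an `f`-fiber lies inside a single `g`-fiber, so the part of that
  -- `f`-fiber in the matching `g`-fiber is closed. It contains the root, hence is everything.
  have hfg : f = g := by
    funext x
    have := (hT (f x)).conn (fiberFinset f (f x) ∩ fiberFinset g (f x)) Finset.inter_subset_left
      ⟨a (f x), Finset.mem_inter.mpr ⟨mem_fiberFinset.mpr (hf _), mem_fiberFinset.mpr (hg _)⟩⟩ ?_
    · exact (mem_fiberFinset.mp (Finset.inter_eq_left.mp this (mem_fiberFinset.mpr rfl))).symm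
    · intro e he z hz hzA
      refine Finset.subset_inter ((hT _).subset e he) ?_
      have he' : e ∈ Finset.univ.biUnion T' :=
        hU ▸ Finset.mem_biUnion.mpr ⟨f x, Finset.mem_univ _, he⟩
      obtain ⟨j, -, hj⟩ := Finset.mem_biUnion.mp he'
      have h1 := mem_fiberFinset.mp ((hT' j).subset e hj hz)
      have h2 := mem_fiberFinset.mp (Finset.mem_inter.mp hzA).2
      rw [← h2, h1]
      exact (hT' j).subset e hj
  subst hfg
  refine ⟨rfl, funext fun i => Finset.ext fun s => ?_⟩
  rw [mem_biUnion_iff_of_subset_fiber hT, mem_biUnion_iff_of_subset_fiber hT', hU]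

/-- Without the edge `a`, the vertices of `a` lie in different components of a tree. -/
theorem IsSpanTree.eq_of_mem_edgeComponent {S : Finset (Finset V)}
    (hS : IsSpanTree Finset.univ S) (ha : Finset.univ.map a ∈ S) {i j : ι} {x : V}
    (hi : x ∈ edgeComponent (S.erase (Finset.univ.map a)) (a i))
    (hj : x ∈ edgeComponent (S.erase (Finset.univ.map a)) (a j)) : i = j := by
  by_contra hij
  set S' := S.erase (Finset.univ.map a)
  -- If `a i` and `a j` shared a component, the other vertices of the deleted edge would still reach
  -- everything, giving `|V| ≤ ∑ (|e| - 1)`, one less than the count allows.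
  have hg := card_le_of_edgeClosed Finset.univ S' ((Finset.univ.map a).erase (a i))
    (fun _ _ => Finset.subset_univ _) (Finset.subset_univ _) ?_
  · have h1 : (Finset.univ.map a).card - 1 + ∑ e ∈ S', (e.card - 1) = ∑ e ∈ S, (e.card - 1) :=
      Finset.add_sum_erase S (fun e => e.card - 1) ha
    have h2 := hS.count
    have h3 : a i ∈ Finset.univ.map a := Finset.mem_map_of_mem a (Finset.mem_univ i)
    have h4 := Finset.card_erase_of_mem h3
    have h5 := hS.two_le _ ha
    omega
  · intro B hB _ hcl
    have hjB : a j ∈ B := hB (Finset.mem_erase.mpr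
      ⟨fun h => hij (a.injective h).symm, Finset.mem_map_of_mem a (Finset.mem_univ j)⟩)
    have hiB : a i ∈ B := by
      by_contra hiB
      have hcl' : EdgeClosed S' (Finset.univ \ B) :=
        EdgeClosed.sdiff (fun _ _ _ _ _ => Finset.subset_univ _) hcl
      have h1 := hcl'.edgeComponent_subset
        (Finset.mem_sdiff.mpr ⟨Finset.mem_univ _, hiB⟩) hi
      exact (Finset.mem_sdiff.mp h1).2 (hcl.edgeComponent_subset hjB hj)
    have hrB : Finset.univ.map a ⊆ B := by
      intro y hy
      by_cases hy' : y = a i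
      · exact hy' ▸ hiB
      · exact hB (Finset.mem_erase.mpr ⟨hy', hy⟩)
    refine hS.conn B (Finset.subset_univ _) ⟨_, hjB⟩ fun e he y hy hyB => ?_
    by_cases hea : e = Finset.univ.map a
    · exact hea ▸ hrB
    · exact hcl e (Finset.mem_erase.mpr ⟨hea, he⟩) y hy hyB

theorem IsSpanTree.exists_glueTrees {S : Finset (Finset V)} (hS : IsSpanTree Finset.univ S)
    (ha : Finset.univ.map a ∈ S) :
    ∃ f : V → ι, (∀ i, f (a i) = i) ∧ ∃ T : ι → Finset (Finset V),
      (∀ i, IsSpanTree (fiberFinset f i) (T i)) ∧ glueTrees a T = S := by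
  classical
  set S' := S.erase (Finset.univ.map a) with hS'
  have hcover : ∀ x, ∃ i, x ∈ edgeComponent S' (a i) := by
    have hne : (Finset.univ.map a).Nonempty :=
      Finset.card_pos.mp (lt_of_lt_of_le two_pos (hS.two_le _ ha))
    have hsub : Finset.univ.map a ⊆ Finset.univ.biUnion fun i => edgeComponent S' (a i) := by
      intro y hy
      obtain ⟨i, -, rfl⟩ := Finset.mem_map.mp hy
      exact Finset.mem_biUnion.mpr ⟨i, Finset.mem_univ i, self_mem_edgeComponent _ _⟩
    have := hS.conn (Finset.univ.biUnion fun i => edgeComponent S' (a i)) (Finset.subset_univ _)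
      (hne.mono hsub) fun e he y hy hyA => ?_
    · intro x
      obtain ⟨i, -, hi⟩ := Finset.mem_biUnion.mp (this.ge (Finset.mem_univ x))
      exact ⟨i, hi⟩
    · by_cases hea : e = Finset.univ.map a
      · exact hea ▸ hsub
      · obtain ⟨i, -, hi⟩ := Finset.mem_biUnion.mp hyA
        exact (edgeClosed_edgeComponent S' (a i) e (Finset.mem_erase.mpr ⟨hea, he⟩) y hy hi).trans
          (Finset.subset_biUnion_of_mem (fun i => edgeComponent S' (a i)) (Finset.mem_univ i))
  choose f hf using hcover
  have hfib : ∀ i, fiberFinset f i = edgeComponent S' (a i) := by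
    intro i
    ext x
    rw [mem_fiberFinset]
    refine ⟨fun h => h ▸ hf x, fun h => hS.eq_of_mem_edgeComponent ha (hf x) h⟩
  have hfa : ∀ i, f (a i) = i := fun i =>
    mem_fiberFinset.mp ((hfib i).symm ▸ self_mem_edgeComponent S' (a i))
  have hclosed : ∀ i, EdgeClosed S' (fiberFinset f i) := fun i =>
    (hfib i).symm ▸ edgeClosed_edgeComponent S' (a i)
  set T : ι → Finset (Finset V) := fun i => S'.filter fun e => e ⊆ fiberFinset f i with hTdef
  have hconn : ∀ i, ∀ A ⊆ fiberFinset f i, A.Nonempty → EdgeClosed (T i) A →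
      A = fiberFinset f i := by
    intro i A hAi hA hcl
    have hcl' : EdgeClosed S' A := by
      intro e he x hx hxA
      exact hcl e (Finset.mem_filter.mpr ⟨he, hclosed i e he x hx (hAi hxA)⟩) x hx hxA
    refine subset_antisymm hAi ?_
    rw [hfib]
    -- If the root is missing from `A`, the rest of the fiber is closed and contains the root's
    -- component, which is the whole fiber.
    by_cases hiA : a i ∈ A
    · exact hcl'.edgeComponent_subset hiA
    · exfalso
      obtain ⟨x, hx⟩ := hA
      have h1 := (EdgeClosed.sdiff (hclosed i) hcl').edgeComponent_subset
        (Finset.mem_sdiff.mpr ⟨mem_fiberFinset.mpr (hfa i), hiA⟩)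
      rw [← hfib] at h1
      exact (Finset.mem_sdiff.mp (h1 (hAi hx))).2 hx
  have hTU : Finset.univ.biUnion T = S' := by
    ext e
    rw [Finset.mem_biUnion]
    constructor
    · rintro ⟨i, -, he⟩
      exact (Finset.mem_filter.mp he).1
    · intro he
      obtain ⟨x, hx⟩ := Finset.card_pos.mp
        (lt_of_lt_of_le two_pos (hS.two_le e (Finset.mem_of_mem_erase he)))
      exact ⟨f x, Finset.mem_univ _, Finset.mem_filter.mpr
        ⟨he, hclosed (f x) e he x hx (mem_fiberFinset.mpr rfl)⟩⟩
  -- Connectedness gives only an inequality on each fiber. Summed over the fibers it is an equality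
  -- by the count for `S`, so it is an equality on each.
  have hle : ∀ i ∈ Finset.univ, (fiberFinset f i).card ≤ 1 + ∑ e ∈ T i, (e.card - 1) := by
    intro i _
    have := card_le_of_edgeClosed (fiberFinset f i) (T i) {a i}
      (fun e he => (Finset.mem_filter.mp he).2)
      (Finset.singleton_subset_iff.mpr (mem_fiberFinset.mpr (hfa i)))
      (fun B hB hBU hcl => hconn i B hBU ⟨_, Finset.singleton_subset_iff.mp hB⟩ hcl)
    rwa [Finset.card_singleton] at this
  have hsum : ∑ i, (fiberFinset f i).card = ∑ i, (1 + ∑ e ∈ T i, (e.card - 1)) := by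
    have hdisj : ∑ e ∈ Finset.univ.biUnion T, (e.card - 1) = ∑ i, ∑ e ∈ T i, (e.card - 1) := by
      refine Finset.sum_biUnion fun i _ j _ hij =>
        Finset.disjoint_left.mpr fun s hi hj => hij ?_
      obtain ⟨hs, hi⟩ := Finset.mem_filter.mp hi
      obtain ⟨x, hx⟩ := Finset.card_pos.mp
        (lt_of_lt_of_le two_pos (hS.two_le s (Finset.mem_of_mem_erase hs)))
      exact (mem_fiberFinset.mp (hi hx)).symm.trans
        (mem_fiberFinset.mp ((Finset.mem_filter.mp hj).2 hx))
    have h1 : (Finset.univ.map a).card - 1 + ∑ e ∈ S', (e.card - 1) = ∑ e ∈ S, (e.card - 1) :=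
      Finset.add_sum_erase S (fun e => e.card - 1) ha
    have h2 := hS.count
    have h3 := hS.two_le _ ha
    have h4 := Finset.card_map (s := Finset.univ) a
    rw [Finset.sum_add_distrib, ← hdisj, hTU, sum_card_fiberFinset, Finset.sum_const, smul_eq_mul,
      mul_one, ← Finset.card_univ (α := V)]
    omega
  have heq := (Finset.sum_eq_sum_iff_of_le hle).mp hsum
  refine ⟨f, hfa, T, fun i => ⟨?_, fun e he => (Finset.mem_filter.mp he).2, hconn i, ?_⟩, ?_⟩
  · exact fun e he => hS.two_le e (Finset.mem_of_mem_erase (Finset.mem_filter.mp he).1)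
  · rw [heq i (Finset.mem_univ i), add_comm]
  · rw [glueTrees, hTU, hS', Finset.insert_erase ha]

theorem card_spanTrees_filter_mem (hk : 2 ≤ Fintype.card ι) (a : ι ↪ V) :
    ((spanTrees (Finset.univ : Finset V)).filter fun S => Finset.univ.map a ∈ S).card =
      ∑ f ∈ Finset.univ.filter fun f : V → ι => ∀ i, f (a i) = i,
        ∏ i, (spanTrees (fiberFinset f i)).card := by
  have h : ∀ f : V → ι, ∏ i, (spanTrees (fiberFinset f i)).card =
      (Fintype.piFinset fun i => spanTrees (fiberFinset f i)).card := fun f =>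
    (Fintype.card_piFinset _).symm
  simp_rw [h]
  rw [← Finset.card_sigma]
  symm
  refine Finset.card_bij (fun p _ => glueTrees a p.2) ?_ ?_ ?_
  · rintro ⟨f, T⟩ hp
    simp only [Finset.mem_sigma, Finset.mem_filter, Finset.mem_univ, true_and,
      Fintype.mem_piFinset, mem_spanTrees] at hp ⊢
    exact ⟨isSpanTree_glueTrees hk hp.1 hp.2, Finset.mem_insert_self _ _⟩
  · rintro ⟨f, T⟩ hp ⟨g, T'⟩ hq h
    simp only [Finset.mem_sigma, Finset.mem_filter, Finset.mem_univ, true_and,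
      Fintype.mem_piFinset, mem_spanTrees] at hp hq
    obtain ⟨rfl, rfl⟩ := glueTrees_injective hk hp.1 hp.2 hq.1 hq.2 h
    rfl
  · intro S hS
    rw [Finset.mem_filter, mem_spanTrees] at hS
    obtain ⟨f, hf, T, hT, rfl⟩ := hS.1.exists_glueTrees hS.2
    refine ⟨⟨f, T⟩, ?_, rfl⟩
    simp only [Finset.mem_sigma, Finset.mem_filter, Finset.mem_univ, true_and,
      Fintype.mem_piFinset, mem_spanTrees]
    exact ⟨hf, hT⟩

end Glue

/-! ### Invariance under renaming of vertices -/

theorem edgeClosed_map {V W : Type} (φ : W ↪ V) {S : Finset (Finset W)} {A : Finset W} :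
    EdgeClosed (S.map (Finset.mapEmbedding φ).toEmbedding) (A.map φ) ↔ EdgeClosed S A := by
  constructor
  · intro h e he x hx hxA
    exact Finset.map_subset_map.mp (h (e.map φ)
      (Finset.mem_map_of_mem (Finset.mapEmbedding φ).toEmbedding he) _
      (Finset.mem_map_of_mem φ hx) (Finset.mem_map_of_mem φ hxA))
  · intro h s hs x hx hxA
    obtain ⟨e, he, rfl⟩ := Finset.mem_map.mp hs
    obtain ⟨y, hy, rfl⟩ := Finset.mem_map.mp hx
    exact Finset.map_subset_map.mpr (h e he y hy ((Finset.mem_map' φ).mp hxA))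

theorem isSpanTree_map {V W : Type} (φ : W ↪ V) {S : Finset (Finset W)} {U : Finset W} :
    IsSpanTree (U.map φ) (S.map (Finset.mapEmbedding φ).toEmbedding) ↔ IsSpanTree U S := by
  have hmem : ∀ e ∈ S, e.map φ ∈ S.map (Finset.mapEmbedding φ).toEmbedding := fun e he =>
    Finset.mem_map_of_mem (Finset.mapEmbedding φ).toEmbedding he
  have hcount : ∑ e ∈ S.map (Finset.mapEmbedding φ).toEmbedding, (e.card - 1) =
      ∑ e ∈ S, (e.card - 1) := by
    rw [Finset.sum_map]
    exact Finset.sum_congr rfl fun e _ => by simp [Finset.mapEmbedding_apply]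
  constructor
  · intro h
    refine ⟨fun e he => ?_, fun e he => ?_, fun A hA hne hcl => ?_, ?_⟩
    · simpa using h.two_le _ (hmem e he)
    · simpa using h.subset _ (hmem e he)
    · exact Finset.map_injective φ (h.conn (A.map φ) (Finset.map_subset_map.mpr hA) (by simpa)
        ((edgeClosed_map φ).mpr hcl))
    · rw [← hcount, h.count, Finset.card_map]
  · intro h
    refine ⟨fun e he => ?_, fun e he => ?_, fun A hA hne hcl => ?_, ?_⟩
    · obtain ⟨s, hs, rfl⟩ := Finset.mem_map.mp he
      simpa [Finset.mapEmbedding_apply] using h.two_le s hs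
    · obtain ⟨s, hs, rfl⟩ := Finset.mem_map.mp he
      simpa [Finset.mapEmbedding_apply] using h.subset s hs
    · obtain ⟨B, hB, rfl⟩ := Finset.subset_map_iff.mp hA
      rw [h.conn B hB (by simpa using hne) ((edgeClosed_map φ).mp hcl)]
    · rw [hcount, h.count, Finset.card_map]

theorem card_spanTrees_map {V W : Type} [Fintype V] [Fintype W] (φ : W ↪ V) :
    (spanTrees (Finset.univ.map φ)).card = (spanTrees (Finset.univ : Finset W)).card := by
  classical
  symm
  refine Finset.card_bij (fun S _ => S.map (Finset.mapEmbedding φ).toEmbedding) ?_ ?_ ?_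
  · intro S hS
    rw [mem_spanTrees] at hS ⊢
    exact (isSpanTree_map φ).mpr hS
  · intro S _ T _ h
    exact Finset.map_injective _ h
  · intro S hS
    rw [mem_spanTrees] at hS
    have hmap : (Finset.univ.filter fun s : Finset W => s.map φ ∈ S).map
        (Finset.mapEmbedding φ).toEmbedding = S := by
      ext s
      rw [Finset.mem_map]
      constructor
      · rintro ⟨t, ht, rfl⟩
        exact (Finset.mem_filter.mp ht).2
      · intro hs
        obtain ⟨t, -, rfl⟩ := Finset.subset_map_iff.mp (hS.subset s hs)
        exact ⟨t, Finset.mem_filter.mpr ⟨Finset.mem_univ _, hs⟩, rfl⟩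
    refine ⟨_, ?_, hmap⟩
    rw [mem_spanTrees, ← isSpanTree_map φ, hmap]
    exact hS

theorem card_spanTrees_eq {V : Type} [Fintype V] (U : Finset V) :
    (spanTrees U).card = (spanTrees (Finset.univ : Finset (Fin U.card))).card := by
  rw [← card_spanTrees_map (U.equivFin.symm.toEmbedding.trans (Function.Embedding.subtype _))]
  congr 2
  ext x
  simp only [Finset.mem_map, Finset.mem_univ, true_and]
  constructor
  · intro hx
    exact ⟨U.equivFin ⟨x, hx⟩, by simp⟩
  · rintro ⟨i, rfl⟩
    exact (U.equivFin.symm i).2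

/-- The vertex count rules out the empty vertex set, whereas the path and cycle conditions hold
there vacuously; comparisons with `numHypertrees` therefore need `n ≠ 0`. -/
theorem card_spanTrees_zero : (spanTrees (Finset.univ : Finset (Fin 0))).card = 0 := by
  rw [Finset.card_eq_zero, Finset.eq_empty_iff_forall_notMem]
  intro S hS
  have := (mem_spanTrees.mp hS).count
  simp at this

theorem numRootedHypertrees_eq_card (n : ℕ) :
    numRootedHypertrees n = n * (spanTrees (Finset.univ : Finset (Fin n))).card := by
  rw [numRootedHypertrees_eq]
  by_cases hn : n = 0
  · simp [hn]
  · rw [numHypertrees_eq_card_spanTrees hn]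

/-! ### Tuples of rooted trees and trees with a marked edge -/

theorem card_embedding_map_eq {V ι : Type} [Fintype V] [DecidableEq V] [Fintype ι] [DecidableEq ι]
    (e : Finset V) :
    (Finset.univ.filter fun a : ι ↪ V => Finset.univ.map a = e).card =
      if e.card = Fintype.card ι then (Fintype.card ι).factorial else 0 := by
  split_ifs with h
  · have hmem : ∀ a : {a : ι ↪ V // Finset.univ.map a = e}, ∀ i, a.1 i ∈ e := fun a i =>
      a.2.le (Finset.mem_map_of_mem a.1 (Finset.mem_univ i))
    have eq : {a : ι ↪ V // Finset.univ.map a = e} ≃ (ι ↪ e) :=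
      { toFun := fun a => ⟨fun i => ⟨a.1 i, hmem a i⟩, fun i j hij =>
          a.1.injective (congrArg Subtype.val hij)⟩
        invFun := fun b => ⟨b.trans (Function.Embedding.subtype _), by
          refine Finset.eq_of_subset_of_card_le ?_ (by simp [h])
          intro x hx
          obtain ⟨i, -, rfl⟩ := Finset.mem_map.mp hx
          exact (b i).2⟩
        left_inv := fun _ => rfl
        right_inv := fun _ => rfl }
    rw [← Fintype.card_subtype, Fintype.card_congr eq, Fintype.card_embedding_eq, Fintype.card_coe,
      h, Nat.descFactorial_self]
  · rw [Finset.card_eq_zero, Finset.filter_eq_empty_iff]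
    rintro a - rfl
    exact h (by rw [Finset.card_map, Finset.card_univ])

/-- Both sides count pairs of a tree and an embedding `ι ↪ V` whose image is an edge: the embedding
lists the roots, and each edge of the right size is the image of `(card ι)!` embeddings. -/
theorem sum_prod_numRootedHypertrees {V ι : Type} [Fintype V] [DecidableEq V] [Fintype ι]
    [DecidableEq ι] (hk : 2 ≤ Fintype.card ι) :
    ∑ f : V → ι, ∏ i, numRootedHypertrees (fiberFinset f i).card =
      (Fintype.card ι).factorial * ∑ S ∈ spanTrees (Finset.univ : Finset V),
        (S.filter fun e => e.card = Fintype.card ι).card := by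
  have h1 : ∀ f : V → ι, ∏ i, numRootedHypertrees (fiberFinset f i).card =
      ∑ a : ι ↪ V, if ∀ i, f (a i) = i then ∏ i, (spanTrees (fiberFinset f i)).card else 0 := by
    intro f
    have h : ∀ i, numRootedHypertrees (fiberFinset f i).card =
        ∑ _x ∈ fiberFinset f i, (spanTrees (fiberFinset f i)).card := by
      intro i
      rw [numRootedHypertrees_eq_card, Finset.sum_const, smul_eq_mul,
        card_spanTrees_eq (fiberFinset f i)]
    simp_rw [h]
    rw [Finset.prod_univ_sum, ← Finset.sum_filter]
    symm
    refine Finset.sum_bij (fun a _ => (a : ι → V)) ?_ ?_ ?_ (fun _ _ => rfl)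
    · intro a ha
      exact Fintype.mem_piFinset.mpr fun i => mem_fiberFinset.mpr ((Finset.mem_filter.mp ha).2 i)
    · intro a _ b _ hab
      exact DFunLike.coe_injective hab
    · intro x hx
      have hx' : ∀ i, f (x i) = i := fun i => mem_fiberFinset.mp (Fintype.mem_piFinset.mp hx i)
      -- Roots in different fibers are automatically distinct, since `f` is a left inverse of the
      -- choice.
      exact ⟨⟨x, Function.LeftInverse.injective hx'⟩,
        Finset.mem_filter.mpr ⟨Finset.mem_univ _, hx'⟩, rfl⟩
  calc _ = ∑ f : V → ι, ∑ a : ι ↪ V,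
        if ∀ i, f (a i) = i then ∏ i, (spanTrees (fiberFinset f i)).card else 0 :=
      Finset.sum_congr rfl fun f _ => h1 f
    _ = ∑ a : ι ↪ V, ((spanTrees (Finset.univ : Finset V)).filter
        fun S => Finset.univ.map a ∈ S).card := by
      rw [Finset.sum_comm]
      refine Finset.sum_congr rfl fun a _ => ?_
      rw [card_spanTrees_filter_mem hk, ← Finset.sum_filter]
    _ = ∑ S ∈ spanTrees (Finset.univ : Finset V),
        (Finset.univ.filter fun a : ι ↪ V => Finset.univ.map a ∈ S).card := by
      simp_rw [Finset.card_filter]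
      exact Finset.sum_comm
    _ = _ := by
      rw [Finset.mul_sum]
      refine Finset.sum_congr rfl fun S _ => ?_
      have hmaps : Set.MapsTo (fun a : ι ↪ V => Finset.univ.map a)
          (Finset.univ.filter fun a : ι ↪ V => Finset.univ.map a ∈ S) S :=
        fun a ha => (Finset.mem_filter.mp ha).2
      rw [Finset.card_eq_sum_card_fiberwise hmaps, Finset.card_filter, Finset.mul_sum]
      refine Finset.sum_congr rfl fun e he => ?_
      rw [Finset.filter_filter, mul_ite, mul_one, mul_zero, ← card_embedding_map_eq]
      congr 1
      ext a
      simp only [Finset.mem_filter, Finset.mem_univ, true_and, and_iff_right_iff_imp]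
      rintro rfl
      exact he

/-! ### Generating functions -/

/-- Powers of an exponential generating function count tuples of structures. -/
theorem factorial_mul_coeff_pow (b : ℕ → ℚ) (n k : ℕ) :
    (n.factorial : ℚ) * PowerSeries.coeff n ((PowerSeries.mk fun m => b m / m.factorial) ^ k) =
      ∑ f : Fin n → Fin k, ∏ i, b (fiberFinset f i).card := by
  -- The functional `L` replaces each exponent `m i` by the weight `b (m i)`. Applied to `(∑ X
  -- i)^n`, it yields the sum over functions `f` from the expanded product, and the coefficient of
  -- the power from the multinomial theorem.
  set L := (MvPolynomial.basisMonomials (Fin k) ℚ).constr ℚ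
    (fun m : Fin k →₀ ℕ => ∏ i, b (m i)) with hL
  have hLm : ∀ m : Fin k →₀ ℕ, L (MvPolynomial.monomial m 1) = ∏ i, b (m i) := by
    intro m
    have := (MvPolynomial.basisMonomials (Fin k) ℚ).constr_basis ℚ
      (fun m : Fin k →₀ ℕ => ∏ i, b (m i)) m
    rwa [MvPolynomial.coe_basisMonomials] at this
  have h1 := congrArg L (Fintype.sum_pow (MvPolynomial.X (R := ℚ) (σ := Fin k)) n)
  rw [Finset.sum_pow_eq_sum_piAntidiag, map_sum, map_sum] at h1
  have h2 : ∀ f : Fin n → Fin k, L (∏ j, MvPolynomial.X (f j)) =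
      ∏ i, b (fiberFinset f i).card := by
    intro f
    have : ∏ j, (MvPolynomial.X (f j) : MvPolynomial (Fin k) ℚ) =
        MvPolynomial.monomial (∑ j, Finsupp.single (f j) 1) 1 := by
      rw [MvPolynomial.monomial_sum_one]
      rfl
    rw [this, hLm]
    refine Finset.prod_congr rfl fun i _ => ?_
    rw [Finsupp.finsetSum_apply, fiberFinset, Finset.card_filter]
    congr 1
    exact Finset.sum_congr rfl fun j _ => Finsupp.single_apply
  simp_rw [h2] at h1
  rw [← h1]
  have h3 : (PowerSeries.mk fun m => b m / m.factorial) ^ k =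
      ∏ _i : Fin k, PowerSeries.mk fun m => b m / (m.factorial : ℚ) := by
    rw [Finset.prod_const, Finset.card_univ, Fintype.card_fin]
  rw [h3, PowerSeries.coeff_prod, Finset.mul_sum]
  refine Finset.sum_bij (fun l _ => (l : Fin k → ℕ)) ?_ ?_ ?_ ?_
  · intro l hl
    rw [Finset.mem_finsuppAntidiag] at hl
    rw [Finset.mem_piAntidiag]
    exact ⟨hl.1, fun _ _ => Finset.mem_univ _⟩
  · intro l _ l' _ h
    exact DFunLike.coe_injective h
  · intro l hl
    rw [Finset.mem_piAntidiag] at hl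
    exact ⟨Finsupp.equivFunOnFinite.symm l,
      Finset.mem_finsuppAntidiag.mpr ⟨hl.1, Finset.subset_univ _⟩, rfl⟩
  · intro l hl
    rw [Finset.mem_finsuppAntidiag] at hl
    have h4 : ∏ i, (MvPolynomial.X i : MvPolynomial (Fin k) ℚ) ^ l i =
        MvPolynomial.monomial l 1 := by
      rw [MvPolynomial.monomial_eq, Finsupp.prod_fintype _ _ (fun _ => pow_zero _)]
      simp
    have h5 := Nat.multinomial_spec Finset.univ l
    rw [hl.1] at h5
    have h6 : (∏ i, ((l i).factorial : ℚ)) ≠ 0 :=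
      Finset.prod_ne_zero_iff.mpr fun i _ => Nat.cast_ne_zero.mpr (Nat.factorial_ne_zero _)
    have h7 : L ((Nat.multinomial Finset.univ l : MvPolynomial (Fin k) ℚ) *
        MvPolynomial.monomial l 1) = Nat.multinomial Finset.univ l * ∏ i, b (l i) := by
      rw [← nsmul_eq_mul, map_nsmul, hLm, nsmul_eq_mul]
    simp only [PowerSeries.coeff_mk]
    rw [h4, h7, Finset.prod_div_distrib, ← h5]
    push_cast
    field_simp

theorem coeff_exp_sub_one_mul (d : ℕ) :
    PowerSeries.coeff d ((PowerSeries.exp ℚ - 1) * (1 - PowerSeries.X)) =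
      if d = 0 then 0 else if d = 1 then 1 else (1 - d : ℚ) / d.factorial := by
  rw [mul_sub, mul_one, map_sub]
  match d with
  | 0 => simp
  | 1 => simp [PowerSeries.coeff_succ_mul_X, PowerSeries.coeff_one, PowerSeries.coeff_exp]
  | d + 2 =>
    rw [PowerSeries.coeff_succ_mul_X]
    have h : ((d + 1).factorial : ℚ) ≠ 0 := Nat.cast_ne_zero.mpr (Nat.factorial_ne_zero _)
    have h' : ((d : ℚ) + 1 + 1) ≠ 0 := by positivity
    simp only [map_sub, PowerSeries.coeff_exp, PowerSeries.coeff_one, Nat.factorial_succ (d + 1)]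
    simp
    field_simp
    ring

theorem factorial_mul_coeff_rooted_pow (n d : ℕ) (hd : 2 ≤ d) :
    (n.factorial : ℚ) * PowerSeries.coeff n (specializeOne rootedHypertreeSeries ^ d) =
      d.factorial * ∑ S ∈ spanTrees (Finset.univ : Finset (Fin n)),
        ((S.filter fun e => e.card = d).card : ℚ) := by
  have h := sum_prod_numRootedHypertrees (V := Fin n) (ι := Fin d) (by simpa using hd)
  rw [Fintype.card_fin] at h
  rw [specializeOne_rootedHypertreeSeries,
    factorial_mul_coeff_pow (fun m => (numRootedHypertrees m : ℚ))]
  exact_mod_cast h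

/-- This is the vertex count with edges grouped by size. Sizes up to `n` would suffice; the range `n
+ 2` also includes `d = 1` when `n = 0`, as the final summation requires. -/
theorem IsSpanTree.sum_card_filter {n : ℕ} {S : Finset (Finset (Fin n))}
    (hS : IsSpanTree Finset.univ S) :
    ∑ d ∈ Finset.range (n + 2), (d - 1 : ℚ) * (S.filter fun e => e.card = d).card = n - 1 := by
  have h1 : ∑ e ∈ S, ((e.card : ℚ) - 1) = n - 1 := by
    have h := congrArg (Nat.cast (R := ℚ)) hS.count
    rw [Finset.card_univ, Fintype.card_fin, Nat.cast_add, Nat.cast_sum, Nat.cast_one] at h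
    rw [← h, add_sub_cancel_right]
    refine Finset.sum_congr rfl fun e he => ?_
    rw [Nat.cast_sub (by have := hS.two_le e he; omega), Nat.cast_one]
  rw [← h1, ← Finset.sum_fiberwise_of_maps_to (g := Finset.card) (t := Finset.range (n + 2))]
  · refine Finset.sum_congr rfl fun d _ => ?_
    rw [Finset.sum_congr rfl fun e he => by rw [(Finset.mem_filter.mp he).2], Finset.sum_const,
      nsmul_eq_mul, mul_comm]
  · intro e _
    have := Finset.card_le_univ e
    rw [Fintype.card_fin] at this
    exact Finset.mem_range.mpr (by omega)

theorem hypertreeSeries_eq_exp_rooted :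
    specializeOne hypertreeSeries =
      ((PowerSeries.exp ℚ).subst (specializeOne rootedHypertreeSeries) - 1) *
        (1 - specializeOne rootedHypertreeSeries) := by
  have hs : PowerSeries.HasSubst (specializeOne rootedHypertreeSeries) := by
    refine PowerSeries.HasSubst.of_constantCoeff_zero' ?_
    rw [specializeOne_rootedHypertreeSeries, ← PowerSeries.coeff_zero_eq_constantCoeff_apply,
      PowerSeries.coeff_mk]
    simp [numRootedHypertrees_eq]
  have hsub : ((PowerSeries.exp ℚ).subst (specializeOne rootedHypertreeSeries) - 1) *
      (1 - specializeOne rootedHypertreeSeries) =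
      ((PowerSeries.exp ℚ - 1) * (1 - PowerSeries.X)).subst
        (specializeOne rootedHypertreeSeries) := by
    rw [← PowerSeries.coe_substAlgHom hs, map_mul, map_sub, map_sub, map_one,
      PowerSeries.substAlgHom_X]
  rw [hsub]
  ext n
  have hn : (n.factorial : ℚ) ≠ 0 := Nat.cast_ne_zero.mpr (Nat.factorial_ne_zero _)
  refine mul_left_cancel₀ hn ?_
  have hleft : (n.factorial : ℚ) * PowerSeries.coeff n (specializeOne hypertreeSeries) =
      (spanTrees (Finset.univ : Finset (Fin n))).card := by
    rw [specializeOne_hypertreeSeries, PowerSeries.coeff_mk]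
    split_ifs with h0
    · subst h0
      rw [card_spanTrees_zero]
      simp
    · rw [numHypertrees_eq_card_spanTrees h0, mul_div_cancel₀ _ hn]
  -- The term `d = 1` counts trees with a marked vertex, and `d ≥ 2` counts marked edges of size `d`
  -- with weight `1 - d`. At `d = 0` the weight is irrelevant, as no edge is empty.
  have hterm : ∀ d, (n.factorial : ℚ) *
      (PowerSeries.coeff d ((PowerSeries.exp ℚ - 1) * (1 - PowerSeries.X)) •
        PowerSeries.coeff n (specializeOne rootedHypertreeSeries ^ d)) =
      (if d = 1 then (n : ℚ) * (spanTrees (Finset.univ : Finset (Fin n))).card else 0) -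
        ∑ S ∈ spanTrees (Finset.univ : Finset (Fin n)),
          (d - 1 : ℚ) * (S.filter fun e => e.card = d).card := by
    intro d
    rw [coeff_exp_sub_one_mul, smul_eq_mul, mul_left_comm]
    match d with
    | 0 =>
      have : ∑ S ∈ spanTrees (Finset.univ : Finset (Fin n)),
          ((0 : ℕ) - 1 : ℚ) * (S.filter fun e => e.card = 0).card = 0 := by
        refine Finset.sum_eq_zero fun S hS => ?_
        rw [Finset.filter_eq_empty_iff.mpr]
        · simp
        · intro e he h
          have := (mem_spanTrees.mp hS).two_le e he
          omega
      rw [this]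
      simp
    | 1 =>
      rw [pow_one, specializeOne_rootedHypertreeSeries, PowerSeries.coeff_mk, mul_div_cancel₀ _ hn,
        numRootedHypertrees_eq_card]
      simp
    | d + 2 =>
      have hd : ((d + 2).factorial : ℚ) ≠ 0 := Nat.cast_ne_zero.mpr (Nat.factorial_ne_zero _)
      rw [factorial_mul_coeff_rooted_pow n (d + 2) (by omega), if_neg (by omega),
        if_neg (by omega), if_neg (by omega), ← Finset.mul_sum, ← mul_assoc,
        div_mul_cancel₀ _ hd]
      ring
  -- After exchanging the sums, each tree contributes `n - (n - 1) = 1`.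
  rw [hleft, PowerSeries.coeff_subst' hs,
    finsum_eq_sum_of_support_subset (s := Finset.range (n + 2)), Finset.mul_sum,
    Finset.sum_congr rfl fun d _ => hterm d, Finset.sum_sub_distrib, Finset.sum_comm,
    Finset.sum_congr rfl fun S hS => (mem_spanTrees.mp hS).sum_card_filter]
  · rw [Finset.sum_ite_eq' (Finset.range (n + 2)) 1, if_pos (Finset.mem_range.mpr (by omega)),
      Finset.sum_const, nsmul_eq_mul]
    ring
  · intro d hd
    by_contra hlt
    rw [Finset.mem_coe, Finset.mem_range] at hlt
    refine hd ((mul_eq_zero_iff_left hn).mp ?_)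
    rw [hterm d, if_neg (by omega), zero_sub, neg_eq_zero]
    refine Finset.sum_eq_zero fun S _ => ?_
    rw [Finset.filter_eq_empty_iff.mpr]
    · simp
    · intro e _ h
      have := Finset.card_le_univ e
      rw [Fintype.card_fin] at this
      omega

theorem mainTheorem6 :
    (specializeOne hypertreeSeries = PowerSeries.mk fun n : ℕ =>
      if n = 0 then 0 else (numHypertrees n : ℚ) / (Nat.factorial n : ℚ)) ∧
    (specializeOne rootedHypertreeSeries = PowerSeries.mk fun n : ℕ =>
      (numRootedHypertrees n : ℚ) / (Nat.factorial n : ℚ)) ∧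
    specializeOne hypertreeSeries =
      ((PowerSeries.exp ℚ).subst (specializeOne rootedHypertreeSeries) - 1) *
        (1 - specializeOne rootedHypertreeSeries) :=
  ⟨specializeOne_hypertreeSeries, specializeOne_rootedHypertreeSeries,
    hypertreeSeries_eq_exp_rooted⟩
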